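/- Let $q$ be an indeterminate. For $n\geqslant 0$ put $[n]=1+q+\cdots+q^{n-1}$ and $[n]!=[n][n-1]\cdots[1]$ (so $[0]!=1$). For nonnegative integers $n,k$ let ${n\brack k}=\frac{(1-q^n)(1-q^{n-1})\cdots(1-q^{n-k+1})}{(1-q)(1-q^2)\cdots(1-q^k)}$ if $k\leqslant n$, and ${n\brack k}=0$ if $k>n$. Let $a$ and $b$ be nonnegative integers and let $p$ be a prime with $p>\max\{a,b\}$. Then $$\frac{[a+b+1]!}{[a]!\,[b]!}\sum_{h=0}^{p-1}q^h{h\brack a}{h\brack b}\equiv(-1)^{a-b}q^{ab-\binom a2-\binom b2}\,[p]\pmod{[p]^2},$$ as a congruence in the ring $\mathbb Z[q,q^{-1}]$ of Laurent polynomials with integer coefficients (both sides lie in this ring). Consequently, in the integers, $$\frac{(a+b+1)!}{a!\,b!}\sum_{h=0}^{p-1}\binom ha\binom hb\equiv(-1)^{a-b}\,p\pmod{p^2}.$$ -/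

import Mathlib

noncomputable section

namespace QAnalog

/-- The indeterminate `q`, in the field of rational functions `ℚ(q)`. -/
def q : RatFunc ℚ := RatFunc.X

/-- The `q`-integer `[n] = 1 + q + ⋯ + q ^ (n - 1)`. -/
def qInt (n : ℕ) : RatFunc ℚ := ∑ i ∈ Finset.range n, q ^ i

/-- The `q`-factorial `[n]! = [n] [n - 1] ⋯ [1]`. -/
def qFactorial (n : ℕ) : RatFunc ℚ := ∏ i ∈ Finset.range n, qInt (i + 1)

/-- The `q`-binomial coefficient
`(1 - q ^ n) ⋯ (1 - q ^ (n - k + 1)) / ((1 - q) ⋯ (1 - q ^ k))` for `k ≤ n`, and `0` for `n < k`. -/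
def qBinomial (n k : ℕ) : RatFunc ℚ :=
  if k ≤ n then
    (∏ i ∈ Finset.range k, (1 - q ^ (n - i))) / ∏ i ∈ Finset.range k, (1 - q ^ (i + 1))
  else 0

/-- The ring `ℤ[q, q⁻¹]` of Laurent polynomials with integer coefficients, inside `ℚ(q)`. -/
def laurentRing : Subalgebra ℤ (RatFunc ℚ) := Algebra.adjoin ℤ {q, q⁻¹}

/-- `x ≡ y (mod m)` in the ring `ℤ[q, q⁻¹]`: both `x` and `y` lie in this ring, and their
difference is a multiple of `m` in it. -/
def LaurentModEq (m x y : RatFunc ℚ) : Prop :=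
  x ∈ laurentRing ∧ y ∈ laurentRing ∧ ∃ f ∈ laurentRing, x - y = m * f

end QAnalog

end

/-!
Write `S(a, b)` for the sum and `n` for `p`. Summation by parts, applied to the product
`[n, a + 1] [n, b + 1]` of `q`-binomial coefficients, expresses `S(a, b + 1)` through `S(a, b)`,
`S(a + 1, b)` and that product. After multiplication by `[a + b + 2]!` the product becomes a
multiple of `[n] ^ 2`, because `[k] [n, k] = [n] [n - 1, k - 1]`, and the claimed value of
`[a + b + 1]! S(a, b)` satisfies the recurrence that remains. Induction on `b` thus reduces the
congruence to `b = 0`, where the sum is `q ^ a [n, a + 1]`. All this holds at a unit `q` of any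
commutative ring, and `[a]! [b]!` can be cancelled modulo `[n] ^ 2` because `[m]` and `[n]`
generate the unit ideal when `m` and `n` are coprime. The two congruences are the cases of the
indeterminate in `ℤ[q, q⁻¹]` and of `1` in `ℤ`.
-/

namespace QAnalog

section CommSemiring

variable {R : Type*} [CommSemiring R] (x : R)

/-- The `q`-integer `[n]` with `q` specialised to an element `x` of a commutative semiring. -/
def intAt (n : ℕ) : R := ∑ i ∈ Finset.range n, x ^ i

/-- The `q`-factorial `[n]!` with `q` specialised to an element `x` of a commutative semiring. -/
def factorialAt (n : ℕ) : R := ∏ i ∈ Finset.range n, intAt x (i + 1)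

/-- The `q`-binomial coefficient with `q` specialised to an element `x` of a commutative semiring.
It is defined by the `q`-Pascal rule, since the quotient formula makes no sense where `[k]!` is not
invertible. -/
def binomAt : ℕ → ℕ → R
  | _, 0 => 1
  | 0, _ + 1 => 0
  | n + 1, k + 1 => binomAt n k + x ^ (k + 1) * binomAt n (k + 1)

/-- The sum `∑ q ^ h [h, a] [h, b]` over `h < n`, with `q` specialised to `x`. -/
def binomSumAt (n a b : ℕ) : R :=
  ∑ h ∈ Finset.range n, x ^ h * binomAt x h a * binomAt x h b

@[simp] lemma intAt_zero : intAt x 0 = 0 := Finset.sum_range_zero _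

@[simp] lemma intAt_one : intAt x 1 = 1 := by simp [intAt]

lemma intAt_add (m n : ℕ) : intAt x (m + n) = intAt x m + x ^ m * intAt x n := by
  simp only [intAt, Finset.sum_range_add, pow_add, Finset.mul_sum]

lemma intAt_succ (n : ℕ) : intAt x (n + 1) = 1 + x * intAt x n := by
  rw [add_comm, intAt_add, intAt_one, pow_one]

lemma intAt_dvd_intAt_mul (m n : ℕ) : intAt x m ∣ intAt x (m * n) := by
  induction n with
  | zero => simp
  | succ n ih =>
    rw [Nat.mul_succ, intAt_add]
    exact dvd_add ih (dvd_mul_left _ _)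

@[simp] lemma intAt_one_left (n : ℕ) : intAt (1 : R) n = n := by simp [intAt]

@[simp] lemma factorialAt_zero : factorialAt x 0 = 1 := Finset.prod_range_zero _

lemma factorialAt_succ (n : ℕ) : factorialAt x (n + 1) = factorialAt x n * intAt x (n + 1) :=
  Finset.prod_range_succ _ _

@[simp] lemma binomAt_zero_right (n : ℕ) : binomAt x n 0 = 1 := by cases n <;> rfl

@[simp] lemma binomAt_zero_succ (k : ℕ) : binomAt x 0 (k + 1) = 0 := rfl

lemma binomAt_succ_succ (n k : ℕ) :
    binomAt x (n + 1) (k + 1) = binomAt x n k + x ^ (k + 1) * binomAt x n (k + 1) := rfl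

lemma binomAt_eq_zero_of_lt {n k : ℕ} (h : n < k) : binomAt x n k = 0 := by
  induction n generalizing k with
  | zero =>
    obtain ⟨k, rfl⟩ := Nat.exists_eq_add_one.2 h
    rfl
  | succ n ih =>
    obtain ⟨k, rfl⟩ := Nat.exists_eq_add_one.2 (Nat.zero_lt_of_lt h)
    rw [binomAt_succ_succ, ih (by lia), ih (by lia), mul_zero, add_zero]

lemma binomAt_one_left (n k : ℕ) : binomAt (1 : R) n k = n.choose k := by
  induction n generalizing k with
  | zero => cases k <;> simp
  | succ n ih => cases k <;> simp [binomAt_succ_succ, ih, Nat.choose_succ_succ']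

-- The factor `x ^ k` avoids the exponent `n - k` of the usual second `q`-Pascal rule.
lemma pow_mul_binomAt_succ_succ (n k : ℕ) :
    x ^ k * binomAt x (n + 1) (k + 1) =
      x ^ n * binomAt x n k + x ^ k * binomAt x n (k + 1) := by
  induction n generalizing k with
  | zero => cases k <;> simp [binomAt_succ_succ]
  | succ n ih =>
    cases k with
    | zero =>
      calc x ^ 0 * binomAt x (n + 2) 1
          = 1 + x * (x ^ 0 * binomAt x (n + 1) 1) := by
            rw [binomAt_succ_succ x (n + 1) 0, binomAt_zero_right]; ring
        _ = 1 + x * (x ^ n * 1 + x ^ 0 * binomAt x n 1) := by rw [ih 0, binomAt_zero_right]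
        _ = x ^ (n + 1) * binomAt x (n + 1) 0 + x ^ 0 * binomAt x (n + 1) 1 := by
            rw [binomAt_succ_succ x n 0, binomAt_zero_right, binomAt_zero_right]; ring
    | succ k =>
      calc x ^ (k + 1) * binomAt x (n + 2) (k + 2)
          = x * (x ^ k * binomAt x (n + 1) (k + 1)) +
              x ^ (k + 2) * (x ^ (k + 1) * binomAt x (n + 1) (k + 2)) := by
            rw [binomAt_succ_succ x (n + 1) (k + 1)]; ring
        _ = x * (x ^ n * binomAt x n k + x ^ k * binomAt x n (k + 1)) +
              x ^ (k + 2) * (x ^ n * binomAt x n (k + 1) + x ^ (k + 1) * binomAt x n (k + 2)) := by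
            rw [ih k, ih (k + 1)]
        _ = x ^ (n + 1) * binomAt x (n + 1) (k + 1) + x ^ (k + 1) * binomAt x (n + 1) (k + 2) := by
            rw [binomAt_succ_succ x n k, binomAt_succ_succ x n (k + 1)]; ring

lemma intAt_mul_binomAt_succ_succ (n k : ℕ) :
    intAt x (k + 1) * binomAt x (n + 1) (k + 1) = intAt x (n + 1) * binomAt x n k := by
  induction n generalizing k with
  | zero => cases k <;> simp [binomAt_succ_succ]
  | succ n ih =>
    cases k with
    | zero =>
      calc intAt x 1 * binomAt x (n + 2) 1
          = 1 + x * (intAt x 1 * binomAt x (n + 1) 1) := by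
            rw [binomAt_succ_succ x (n + 1) 0, binomAt_zero_right, intAt_one]; ring
        _ = intAt x (n + 2) * binomAt x (n + 1) 0 := by
            rw [ih 0, intAt_succ x (n + 1), binomAt_zero_right, binomAt_zero_right]; ring
    | succ k =>
      calc intAt x (k + 2) * binomAt x (n + 2) (k + 2)
          = binomAt x (n + 1) (k + 1) + x * (intAt x (k + 1) * binomAt x (n + 1) (k + 1)) +
              x ^ (k + 2) * (intAt x (k + 2) * binomAt x (n + 1) (k + 2)) := by
            rw [binomAt_succ_succ x (n + 1) (k + 1), mul_add, intAt_succ x (k + 1)]; ring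
        _ = binomAt x (n + 1) (k + 1) + x * (intAt x (n + 1) * binomAt x n k) +
              x ^ (k + 2) * (intAt x (n + 1) * binomAt x n (k + 1)) := by
            rw [ih k, ih (k + 1)]
        _ = intAt x (n + 2) * binomAt x (n + 1) (k + 1) := by
            rw [intAt_succ x (n + 1), binomAt_succ_succ x n k]; ring

lemma factorialAt_add (m k : ℕ) :
    factorialAt x (m + k) = factorialAt x m * factorialAt x k * binomAt x (m + k) k := by
  induction k with
  | zero => simp
  | succ k ih =>
    calc factorialAt x (m + k + 1)
        = factorialAt x m * factorialAt x k *
            (intAt x (m + k + 1) * binomAt x (m + k) k) := by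
          rw [factorialAt_succ, ih]; ring
      _ = factorialAt x m * factorialAt x (k + 1) * binomAt x (m + k + 1) (k + 1) := by
          rw [← intAt_mul_binomAt_succ_succ, factorialAt_succ]; ring

lemma factorialAt_add_add_one (a b : ℕ) :
    factorialAt x (a + b + 1) = factorialAt x a * factorialAt x b *
      (binomAt x (a + b) b * intAt x (a + b + 1)) := by
  rw [factorialAt_succ, factorialAt_add, mul_assoc]

lemma sq_intAt_dvd_factorialAt_mul_binomAt_mul_binomAt (n a b : ℕ) :
    intAt x (n + 1) ^ 2 ∣ factorialAt x (a + b + 2) *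
      (binomAt x (n + 1) (a + 1) * binomAt x (n + 1) (b + 1)) := by
  refine ⟨factorialAt x a * factorialAt x b * binomAt x (a + b + 2) (b + 1) *
    (binomAt x n a * binomAt x n b), ?_⟩
  calc factorialAt x (a + b + 2) * (binomAt x (n + 1) (a + 1) * binomAt x (n + 1) (b + 1))
      = factorialAt x a * factorialAt x b * binomAt x (a + b + 2) (b + 1) *
          ((intAt x (a + 1) * binomAt x (n + 1) (a + 1)) *
            (intAt x (b + 1) * binomAt x (n + 1) (b + 1))) := by
        rw [show a + b + 2 = a + 1 + (b + 1) by ring, factorialAt_add, factorialAt_succ x a,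
          factorialAt_succ x b]
        ring
    _ = _ := by
        rw [intAt_mul_binomAt_succ_succ, intAt_mul_binomAt_succ_succ]
        ring

lemma binomSumAt_zero_right (n a : ℕ) :
    binomSumAt x n a 0 = x ^ a * binomAt x n (a + 1) := by
  induction n with
  | zero => simp [binomSumAt]
  | succ n ih =>
    rw [binomSumAt, Finset.sum_range_succ, ← binomSumAt, ih, pow_mul_binomAt_succ_succ,
      binomAt_zero_right, mul_one, add_comm]

lemma pow_mul_binomAt_mul_binomAt_succ (h a b : ℕ) :
    x ^ (a + b) * (binomAt x (h + 1) (a + 1) * binomAt x (h + 1) (b + 1)) =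
      x ^ (a + b) * (binomAt x h (a + 1) * binomAt x h (b + 1)) +
        (x ^ b * (x ^ h * binomAt x h a * binomAt x h (b + 1)) +
          x ^ a * (x ^ h * binomAt x h a * binomAt x h b) +
          x ^ (2 * a + 1) * (x ^ h * binomAt x h (a + 1) * binomAt x h b)) :=
  calc x ^ (a + b) * (binomAt x (h + 1) (a + 1) * binomAt x (h + 1) (b + 1))
      = x ^ a * binomAt x (h + 1) (a + 1) * (x ^ b * binomAt x (h + 1) (b + 1)) := by ring
    _ = x ^ a * x ^ h * binomAt x (h + 1) (a + 1) * binomAt x h b +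
          x ^ b * (x ^ a * binomAt x (h + 1) (a + 1)) * binomAt x h (b + 1) := by
        rw [pow_mul_binomAt_succ_succ x h b]; ring
    _ = x ^ a * x ^ h * (binomAt x h a + x ^ (a + 1) * binomAt x h (a + 1)) * binomAt x h b +
          x ^ b * (x ^ h * binomAt x h a + x ^ a * binomAt x h (a + 1)) * binomAt x h (b + 1) := by
        rw [pow_mul_binomAt_succ_succ x h a, binomAt_succ_succ x h a]
    _ = _ := by ring

lemma pow_mul_binomAt_mul_binomAt_eq_binomSumAt (n a b : ℕ) :
    x ^ (a + b) * (binomAt x n (a + 1) * binomAt x n (b + 1)) =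
      x ^ b * binomSumAt x n a (b + 1) + x ^ a * binomSumAt x n a b +
        x ^ (2 * a + 1) * binomSumAt x n (a + 1) b := by
  induction n with
  | zero => simp [binomSumAt]
  | succ n ih =>
    rw [pow_mul_binomAt_mul_binomAt_succ, ih]
    simp only [binomSumAt, Finset.sum_range_succ]
    ring

section Map

variable {S F : Type*} [CommSemiring S] [FunLike F R S] [RingHomClass F R S] (f : F)

lemma map_intAt (n : ℕ) : f (intAt x n) = intAt (f x) n := by
  simp [intAt]

lemma map_binomAt (n k : ℕ) : f (binomAt x n k) = binomAt (f x) n k := by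
  induction n generalizing k with
  | zero => cases k <;> simp
  | succ n ih => cases k <;> simp [binomAt_succ_succ, ih]

lemma map_binomSumAt (n a b : ℕ) : f (binomSumAt x n a b) = binomSumAt (f x) n a b := by
  simp [binomSumAt, map_binomAt]

end Map

end CommSemiring

section CommRing

variable {R : Type*} [CommRing R]

lemma prod_one_sub_pow_mul_binomAt (x : R) (n k : ℕ) :
    (∏ i ∈ Finset.range k, (1 - x ^ (i + 1))) * binomAt x n k =
      ∏ i ∈ Finset.range k, (1 - x ^ (n - i)) := by
  induction k generalizing n with
  | zero => simp
  | succ k ih =>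
    cases n with
    | zero => simp [Finset.prod_range_succ]
    | succ n =>
      have one_sub_mul_intAt (m : ℕ) : (1 - x) * intAt x m = 1 - x ^ m := mul_neg_geom_sum x m
      calc (∏ i ∈ Finset.range (k + 1), (1 - x ^ (i + 1))) * binomAt x (n + 1) (k + 1)
          = (∏ i ∈ Finset.range k, (1 - x ^ (i + 1))) * (1 - x) *
              (intAt x (k + 1) * binomAt x (n + 1) (k + 1)) := by
            rw [Finset.prod_range_succ, ← one_sub_mul_intAt (k + 1)]; ring
        _ = (∏ i ∈ Finset.range k, (1 - x ^ (i + 1))) * binomAt x n k * (1 - x ^ (n + 1)) := by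
            rw [intAt_mul_binomAt_succ_succ, ← one_sub_mul_intAt (n + 1)]; ring
        _ = ∏ i ∈ Finset.range (k + 1), (1 - x ^ (n + 1 - i)) := by
            rw [ih, Finset.prod_range_succ']
            simp only [Nat.add_sub_add_right, Nat.sub_zero]

-- Euclid's algorithm on the indices: `[n] = [n % m] + q ^ (n % m) [m * (n / m)]`.
lemma isCoprime_intAt (x : R) {m n : ℕ} (h : m.Coprime n) :
    IsCoprime (intAt x m) (intAt x n) := by
  induction m, n using Nat.gcd.induction with
  | H0 n =>
    rw [Nat.coprime_zero_left] at h
    simpa [h] using isCoprime_one_right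
  | H1 m n _ ih =>
    obtain ⟨c, hc⟩ := intAt_dvd_intAt_mul x m (n / m)
    have h_mod : IsCoprime (intAt x m) (intAt x (n % m)) :=
      (ih (by rwa [Nat.Coprime, ← Nat.gcd_rec])).symm
    rw [← Nat.mod_add_div n m, intAt_add, hc, mul_left_comm]
    exact h_mod.add_mul_left_right _

lemma isCoprime_intAt_factorialAt (x : R) {n a : ℕ} (h : n.Coprime a.factorial) :
    IsCoprime (intAt x n) (factorialAt x a) :=
  IsCoprime.prod_right fun i hi ↦ isCoprime_intAt x <|
    h.coprime_dvd_right <| Nat.dvd_factorial i.succ_pos <| Finset.mem_range.1 hi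

section Units

variable (x : Rˣ)

/-- The unit `(-1) ^ (a - b) q ^ (ab - binom(a, 2) - binom(b, 2))` with `q` specialised to a unit
`x`: the cofactor of `[n]` on the right-hand side of the congruence. The exponents are integers. -/
def residueUnit (a b : ℕ) : Rˣ :=
  (-1) ^ ((a : ℤ) - b) * x ^ ((a : ℤ) * b - a.choose 2 - b.choose 2)

@[simp] lemma residueUnit_zero_zero : residueUnit x 0 0 = 1 := by simp [residueUnit]

lemma pow_mul_residueUnit_succ_right (a b : ℕ) :
    (x : R) ^ b * residueUnit x a (b + 1) = -(x ^ a * residueUnit x a b) := by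
  have h_sign : (-1 : Rˣ) ^ ((a : ℤ) - (b + 1 : ℕ)) = -(-1) ^ ((a : ℤ) - b) := by
    rw [Nat.cast_succ, ← sub_sub, zpow_sub_one, inv_neg_one, mul_neg_one]
  have h_pow : x ^ b * x ^ ((a : ℤ) * (b + 1 : ℕ) - a.choose 2 - (b + 1).choose 2) =
      x ^ a * x ^ ((a : ℤ) * b - a.choose 2 - b.choose 2) := by
    rw [← zpow_natCast, ← zpow_natCast, ← zpow_add, ← zpow_add, Nat.choose_succ_succ' b 1,
      Nat.choose_one_right]
    push_cast
    ring_nf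
  have h : x ^ b * residueUnit x a (b + 1) = -(x ^ a * residueUnit x a b) := by
    rw [residueUnit, residueUnit, h_sign, mul_left_comm, h_pow, neg_mul, mul_left_comm]
  exact_mod_cast congrArg Units.val h

lemma residueUnit_comm (a b : ℕ) : residueUnit x a b = residueUnit x b a := by
  rw [residueUnit, residueUnit, ← neg_sub (b : ℤ) a, zpow_neg, ← inv_zpow, inv_neg_one,
    mul_comm (a : ℤ) b, sub_right_comm]

lemma pow_mul_residueUnit_succ_left (a b : ℕ) :
    (x : R) ^ a * residueUnit x (a + 1) b = -(x ^ b * residueUnit x a b) := by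
  rw [residueUnit_comm x (a + 1), pow_mul_residueUnit_succ_right, residueUnit_comm]

lemma map_residueUnit {S : Type*} [CommRing S] (f : R →+* S) (a b : ℕ) :
    Units.map (f : R →* S) (residueUnit x a b) = residueUnit (Units.map (f : R →* S) x) a b := by
  have h_neg_one : Units.map (f : R →* S) (-1) = -1 := Units.ext (by simp)
  rw [residueUnit, residueUnit, map_mul, map_zpow, map_zpow, h_neg_one]

lemma intAt_dvd_factorialAt_mul_binomAt_sub (n a : ℕ) :
    intAt (x : R) (n + 1) ∣
      factorialAt (x : R) a * (x ^ a * binomAt (x : R) n a - residueUnit x a 0) := by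
  induction a with
  | zero => simp
  | succ a ih =>
    have h_step : (x : R) ^ a * (factorialAt (x : R) (a + 1) *
          (x ^ (a + 1) * binomAt (x : R) n (a + 1) - residueUnit x (a + 1) 0)) =
        intAt (x : R) (n + 1) * (x ^ a * factorialAt (x : R) a * binomAt (x : R) n a) -
          intAt (x : R) (a + 1) *
            (factorialAt (x : R) a * (x ^ a * binomAt (x : R) n a - residueUnit x a 0)) := by
      have h_absorb := intAt_mul_binomAt_succ_succ (x : R) n a
      rw [binomAt_succ_succ] at h_absorb
      rw [factorialAt_succ]
      linear_combination (x : R) ^ a * factorialAt (x : R) a * h_absorb -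
        factorialAt (x : R) a * intAt (x : R) (a + 1) * pow_mul_residueUnit_succ_left x a 0
    rw [← (x.isUnit.pow a).dvd_mul_left, h_step]
    exact dvd_sub (dvd_mul_right _ _) (ih.mul_left _)

/-- The difference of the two sides of the congruence, with `q` specialised to a unit `x` and
both sides multiplied by `[a]! [b]!`. -/
def congruenceDefect (n a b : ℕ) : R :=
  factorialAt (x : R) (a + b + 1) * binomSumAt (x : R) n a b -
    factorialAt (x : R) a * factorialAt (x : R) b * (residueUnit x a b * intAt (x : R) n)

lemma pow_mul_congruenceDefect_succ_right (n a b : ℕ) :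
    (x : R) ^ b * congruenceDefect x n a (b + 1) =
      x ^ (a + b) * (factorialAt (x : R) (a + b + 2) *
        (binomAt (x : R) n (a + 1) * binomAt (x : R) n (b + 1))) -
      x ^ a * intAt (x : R) (a + b + 2) * congruenceDefect x n a b -
      x ^ (2 * a + 1) * congruenceDefect x n (a + 1) b := by
  have h_int : intAt (x : R) (a + b + 2) =
      intAt (x : R) (b + 1) + x ^ (b + 1) * intAt (x : R) (a + 1) := by
    rw [← intAt_add]; ring_nf
  have h_fac : factorialAt (x : R) (a + b + 2) =
      factorialAt (x : R) (a + b + 1) * intAt (x : R) (a + b + 2) := factorialAt_succ _ _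
  rw [congruenceDefect, congruenceDefect, congruenceDefect, ← add_assoc, add_right_comm a 1 b,
    factorialAt_succ _ a, factorialAt_succ _ b]
  linear_combination
    -factorialAt (x : R) (a + b + 2) * pow_mul_binomAt_mul_binomAt_eq_binomSumAt (x : R) n a b -
    x ^ a * binomSumAt (x : R) n a b * h_fac -
    factorialAt (x : R) a * factorialAt (x : R) b * intAt (x : R) n *
      (intAt (x : R) (b + 1) * pow_mul_residueUnit_succ_right x a b +
        x ^ (a + 1) * intAt (x : R) (a + 1) * pow_mul_residueUnit_succ_left x a b +
        x ^ a * residueUnit x a b * h_int)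

lemma congruenceDefect_zero_right (n a : ℕ) :
    congruenceDefect x (n + 1) a 0 = intAt (x : R) (n + 1) *
      (factorialAt (x : R) a * (x ^ a * binomAt (x : R) n a - residueUnit x a 0)) := by
  rw [congruenceDefect, binomSumAt_zero_right, add_zero, factorialAt_succ, factorialAt_zero]
  linear_combination factorialAt (x : R) a * x ^ a * intAt_mul_binomAt_succ_succ (x : R) n a

theorem sq_intAt_dvd_congruenceDefect (n a b : ℕ) :
    intAt (x : R) n ^ 2 ∣ congruenceDefect x n a b := by
  cases n with
  | zero => simp [congruenceDefect, binomSumAt]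
  | succ n =>
    induction b generalizing a with
    | zero =>
      rw [congruenceDefect_zero_right, sq]
      exact mul_dvd_mul_left _ (intAt_dvd_factorialAt_mul_binomAt_sub x n a)
    | succ b ih =>
      rw [← (x.isUnit.pow b).dvd_mul_left, pow_mul_congruenceDefect_succ_right]
      exact dvd_sub (dvd_sub
        ((sq_intAt_dvd_factorialAt_mul_binomAt_mul_binomAt (x : R) n a b).mul_left _)
        ((ih a).mul_left _)) ((ih (a + 1)).mul_left _)

theorem sq_intAt_dvd_of_coprime {n a b : ℕ} (ha : n.Coprime a.factorial)
    (hb : n.Coprime b.factorial) :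
    intAt (x : R) n ^ 2 ∣
      binomAt (x : R) (a + b) b * intAt (x : R) (a + b + 1) * binomSumAt (x : R) n a b -
        residueUnit x a b * intAt (x : R) n := by
  have h_coprime : IsCoprime (intAt (x : R) n ^ 2)
      (factorialAt (x : R) a * factorialAt (x : R) b) :=
    ((isCoprime_intAt_factorialAt _ ha).mul_right (isCoprime_intAt_factorialAt _ hb)).pow_left
  refine h_coprime.dvd_of_dvd_mul_left ?_
  convert sq_intAt_dvd_congruenceDefect x n a b using 1
  rw [congruenceDefect, factorialAt_add_add_one]
  ring

end Units

end CommRing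

section LaurentRing

lemma q_pow_ne_one {n : ℕ} (hn : n ≠ 0) : q ^ n ≠ 1 := by
  intro h
  have h_poly : (Polynomial.X ^ n : Polynomial ℚ) = 1 :=
    RatFunc.algebraMap_injective ℚ (by simpa [q] using h)
  exact hn (by simpa using congrArg Polynomial.natDegree h_poly)

lemma qInt_ne_zero {n : ℕ} (hn : n ≠ 0) : qInt n ≠ 0 := by
  intro h
  have h_geom : (1 - q) * qInt n = 1 - q ^ n := mul_neg_geom_sum q n
  rw [h, mul_zero] at h_geom
  exact q_pow_ne_one hn (sub_eq_zero.1 h_geom.symm).symm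

lemma qFactorial_ne_zero (n : ℕ) : qFactorial n ≠ 0 :=
  Finset.prod_ne_zero_iff.2 fun i _ ↦ qInt_ne_zero i.succ_ne_zero

lemma qBinomial_eq_binomAt (n k : ℕ) : qBinomial n k = binomAt q n k := by
  unfold qBinomial
  split_ifs with h
  · rw [div_eq_iff, mul_comm, prod_one_sub_pow_mul_binomAt]
    exact Finset.prod_ne_zero_iff.2 fun i _ ↦ sub_ne_zero.2 (q_pow_ne_one i.succ_ne_zero).symm
  · exact (binomAt_eq_zero_of_lt q (not_le.1 h)).symm

lemma qFactorial_div_mul_sum_eq (a b n : ℕ) :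
    qFactorial (a + b + 1) / (qFactorial a * qFactorial b) *
        ∑ h ∈ Finset.range n, q ^ h * qBinomial h a * qBinomial h b =
      binomAt q (a + b) b * intAt q (a + b + 1) * binomSumAt q n a b := by
  have h_fac : qFactorial (a + b + 1) = qFactorial a * qFactorial b *
    (binomAt q (a + b) b * intAt q (a + b + 1)) := factorialAt_add_add_one q a b
  rw [h_fac, mul_div_cancel_left₀ _ (mul_ne_zero (qFactorial_ne_zero a) (qFactorial_ne_zero b))]
  simp only [qBinomial_eq_binomAt, binomSumAt]

/-- The indeterminate `q` as a unit of `ℤ[q, q⁻¹]`, at which the congruence is specialised. -/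
noncomputable def laurentQ : laurentRingˣ where
  val := ⟨q, Algebra.subset_adjoin (Set.mem_insert _ _)⟩
  inv := ⟨q⁻¹, Algebra.subset_adjoin (Set.mem_insert_of_mem _ rfl)⟩
  val_inv := Subtype.ext (mul_inv_cancel₀ RatFunc.X_ne_zero)
  inv_val := Subtype.ext (inv_mul_cancel₀ RatFunc.X_ne_zero)

lemma coe_residueUnit_laurentQ (a b : ℕ) :
    ((residueUnit laurentQ a b : laurentRing) : RatFunc ℚ) =
      (-1) ^ ((a : ℤ) - b) * q ^ ((a : ℤ) * b - a.choose 2 - b.choose 2) := by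
  let φ : laurentRing →+* RatFunc ℚ := laurentRing.val
  calc ((residueUnit laurentQ a b : laurentRing) : RatFunc ℚ)
      = (residueUnit (Units.map (φ : laurentRing →* RatFunc ℚ) laurentQ) a b : RatFunc ℚ) :=
        congrArg Units.val (map_residueUnit laurentQ φ a b)
    _ = _ := by
        rw [residueUnit, Units.val_mul, Units.val_zpow_eq_zpow_val, Units.val_zpow_eq_zpow_val]
        rfl

lemma laurentModEq_of_dvd_sub {m x y : laurentRing} (h : m ∣ x - y) : LaurentModEq m x y := by
  obtain ⟨c, hc⟩ := h
  exact ⟨x.2, y.2, c, c.2, by exact_mod_cast congrArg Subtype.val hc⟩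

theorem laurentModEq_of_coprime {n a b : ℕ} (ha : n.Coprime a.factorial)
    (hb : n.Coprime b.factorial) :
    LaurentModEq (qInt n ^ 2)
      (qFactorial (a + b + 1) / (qFactorial a * qFactorial b) *
        ∑ h ∈ Finset.range n, q ^ h * qBinomial h a * qBinomial h b)
      ((-1) ^ ((a : ℤ) - b) * q ^ ((a : ℤ) * b - a.choose 2 - b.choose 2) * qInt n) := by
  have h := laurentModEq_of_dvd_sub (sq_intAt_dvd_of_coprime laurentQ ha hb)
  have h_coe (z : laurentRing) : (z : RatFunc ℚ) = laurentRing.val z := rfl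
  have h_q : laurentRing.val (laurentQ : laurentRing) = q := rfl
  rw [qFactorial_div_mul_sum_eq, show qInt n = intAt q n from rfl, ← coe_residueUnit_laurentQ]
  simpa only [h_coe, map_mul, map_pow, map_intAt, map_binomAt, map_binomSumAt, h_q] using h

end LaurentRing

section Integers

open Nat

lemma factorial_add_add_one (a b : ℕ) :
    (a + b + 1)! = a ! * b ! * ((a + b).choose b * (a + b + 1)) := by
  rw [factorial_succ, ← add_choose_mul_factorial_mul_factorial]
  ring

theorem choose_sum_modEq_of_coprime {n a b : ℕ} (ha : n.Coprime a !) (hb : n.Coprime b !) :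
    (((a + b + 1)! / (a ! * b !) *
        ∑ h ∈ Finset.range n, h.choose a * h.choose b : ℕ) : ℤ) ≡
      (((-1 : ℤˣ) ^ ((a : ℤ) - b) : ℤˣ) : ℤ) * n [ZMOD (n : ℤ) ^ 2] := by
  have h := sq_intAt_dvd_of_coprime (1 : ℤˣ) ha hb
  simp only [residueUnit, binomSumAt, Units.val_one, one_zpow, one_pow, one_mul, mul_one,
    binomAt_one_left, intAt_one_left] at h
  rw [factorial_add_add_one, Nat.mul_div_cancel_left _ (by positivity)]
  exact (Int.modEq_iff_dvd.2 (by exact_mod_cast h)).symm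

end Integers

end QAnalog

open QAnalog in
theorem theorem2_general (a b n : ℕ) (hn : n.Coprime (max a b).factorial) :
    LaurentModEq (qInt n ^ 2)
      (qFactorial (a + b + 1) / (qFactorial a * qFactorial b) *
        ∑ h ∈ Finset.range n, q ^ h * qBinomial h a * qBinomial h b)
      ((-1) ^ ((a : ℤ) - (b : ℤ)) *
        q ^ ((a : ℤ) * (b : ℤ) - (a.choose 2 : ℤ) - (b.choose 2 : ℤ)) *
        qInt n) ∧
    a.factorial * b.factorial ∣ (a + b + 1).factorial ∧
    (((a + b + 1).factorial / (a.factorial * b.factorial) *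
        ∑ h ∈ Finset.range n, h.choose a * h.choose b : ℕ) : ℤ) ≡
      (((-1 : ℤˣ) ^ ((a : ℤ) - (b : ℤ)) : ℤˣ) : ℤ) * (n : ℤ) [ZMOD (n : ℤ) ^ 2] :=
  have ha := hn.coprime_dvd_right (Nat.factorial_dvd_factorial (le_max_left a b))
  have hb := hn.coprime_dvd_right (Nat.factorial_dvd_factorial (le_max_right a b))
  ⟨laurentModEq_of_coprime ha hb, ⟨_, factorial_add_add_one a b⟩, choose_sum_modEq_of_coprime ha hb⟩

theorem theorem2 (a b p : ℕ) (hp : p.Prime) (hab : max a b < p) :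
    QAnalog.LaurentModEq (QAnalog.qInt p ^ 2)
      (QAnalog.qFactorial (a + b + 1) / (QAnalog.qFactorial a * QAnalog.qFactorial b) *
        ∑ h ∈ Finset.range p, QAnalog.q ^ h * QAnalog.qBinomial h a * QAnalog.qBinomial h b)
      ((-1) ^ ((a : ℤ) - (b : ℤ)) *
        QAnalog.q ^ ((a : ℤ) * (b : ℤ) - (a.choose 2 : ℤ) - (b.choose 2 : ℤ)) *
        QAnalog.qInt p) ∧
    a.factorial * b.factorial ∣ (a + b + 1).factorial ∧
    (((a + b + 1).factorial / (a.factorial * b.factorial) *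
        ∑ h ∈ Finset.range p, h.choose a * h.choose b : ℕ) : ℤ) ≡
      (((-1 : ℤˣ) ^ ((a : ℤ) - (b : ℤ)) : ℤˣ) : ℤ) * (p : ℤ) [ZMOD (p : ℤ) ^ 2] :=
  theorem2_general a b p ((Nat.coprime_factorial_iff hp.ne_one).2 (by rwa [hp.minFac_eq]))
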